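/- Let $R$ be a commutative noetherian ring with identity that is Cohen–Macaulay, i.e. $\operatorname{depth} R_{\mathfrak q} = \dim R_{\mathfrak q}$ for every prime ideal $\mathfrak q$ of $R$. Let $D$ be a dualizing $R$-module, that is, a finitely generated $R$-module of finite injective dimension such that the homothety map $R \to \operatorname{Hom}_R(D,D)$ is an isomorphism and $\operatorname{Ext}^i_R(D,D) = 0$ for all $i \geq 1$. Let $\mathfrak p$ be a prime ideal of $R$ and let $E_R(R/\mathfrak p)$ be the injective hull of $R/\mathfrak p$. Let $G$ be a Gorenstein injective $R$-module, that is, suppose there is an exact sequence of injective $R$-modules $$X = \cdots \to E_1 \to E_0 \to E^0 \to E^1 \to \cdots$$ such that $\operatorname{Hom}_R(J, X)$ is exact for every injective $R$-module $J$ and $G \cong \operatorname{Im}(E_0 \to E^0)$. Then $$\operatorname{Tor}_k^R(\operatorname{Hom}_R(D, E_R(R/\mathfrak p)), G) = 0$$ for every integer $k \geq 0$ with $k \neq \operatorname{ht}(\mathfrak p)$. -/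

import Mathlib

open CategoryTheory

universe u

/-- The depth of a local ring `A`: the supremum of the lengths of the `A`-regular sequences
contained in the maximal ideal. -/
noncomputable def localRingDepth (A : Type u) [CommRing A] [IsLocalRing A] : ℕ∞ :=
  ⨆ (rs : List A) (_ : RingTheory.Sequence.IsRegular A rs)
    (_ : ∀ r ∈ rs, r ∈ IsLocalRing.maximalIdeal A), (rs.length : ℕ∞)

/-- A noetherian ring is Cohen–Macaulay if `depth R_𝔭 = dim R_𝔭` for every prime ideal `𝔭`. -/
def IsCohenMacaulayRing (R : Type u) [CommRing R] : Prop :=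
  IsNoetherianRing R ∧ ∀ (p : Ideal R) [p.IsPrime],
    (localRingDepth (Localization.AtPrime p) : WithBot ℕ∞) =
      ringKrullDim (Localization.AtPrime p)

/-- A semidualizing module: finitely generated, the homothety map `R → Hom_R(C, C)` is an
isomorphism, and `Ext^i_R(C, C) = 0` for all `i ≥ 1`. -/
structure IsSemidualizingModule (R : Type u) [CommRing R]
    (C : Type u) [AddCommGroup C] [Module R C] : Prop where
  finite : Module.Finite R C
  homothety_bijective : Function.Bijective (LinearMap.lsmul R C)
  ext_subsingleton : ∀ i : ℕ, 1 ≤ i →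
    Subsingleton (Abelian.Ext (ModuleCat.of R C) (ModuleCat.of R C) i)

/-- A dualizing module: a semidualizing module of finite injective dimension. -/
structure IsDualizingModule (R : Type u) [CommRing R]
    (D : Type u) [AddCommGroup D] [Module R D] : Prop
    extends IsSemidualizingModule R D where
  finite_injectiveDimension : ∃ n : ℕ, HasInjectiveDimensionLE (ModuleCat.of R D) n

/-- The map `ι : M → E` is an injective hull of `M`: `E` is injective, `ι` is injective, and every
nonzero submodule of `E` meets the image of `ι` nontrivially. -/
structure IsInjectiveHull {R : Type u} [CommRing R]
    {M : Type u} [AddCommGroup M] [Module R M] {E : Type u} [AddCommGroup E] [Module R E]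
    (ι : M →ₗ[R] E) : Prop where
  injective_module : Module.Injective R E
  injective_map : Function.Injective ι
  essential : ∀ N : Submodule R E, N ⊓ LinearMap.range ι = ⊥ → N = ⊥

/-- The sequence `⋯ → E (-1) → E 0 → E 1 → ⋯` is a complete injective resolution: it is an exact
sequence of injective modules which stays exact under `Hom_R(J, -)` for every injective `J`. -/
structure IsCompleteInjectiveResolution {R : Type u} [CommRing R] (E : ℤ → ModuleCat.{u} R)
    (d : ∀ n : ℤ, E n →ₗ[R] E (n + 1)) : Prop where
  injective : ∀ n : ℤ, Module.Injective R (E n)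
  exact : ∀ n : ℤ, Function.Exact (d n) (d (n + 1))
  hom_exact : ∀ (J : Type u) [AddCommGroup J] [Module R J], Module.Injective R J → ∀ n : ℤ,
    Function.Exact (fun f : J →ₗ[R] E n => (d n).comp f)
      (fun f : J →ₗ[R] E (n + 1) => (d (n + 1)).comp f)

/-- A module is Gorenstein injective if it is isomorphic to the image of a map in a complete
injective resolution (after reindexing, of the map in degree `0`). -/
def IsGorensteinInjective (R : Type u) [CommRing R]
    (G : Type u) [AddCommGroup G] [Module R G] : Prop :=
  ∃ (E : ℤ → ModuleCat.{u} R) (d : ∀ n : ℤ, E n →ₗ[R] E (n + 1)),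
    IsCompleteInjectiveResolution E d ∧ Nonempty (G ≃ₗ[R] LinearMap.range (d 0))

/-! Write `T = Hom(D, E)`, `⁺` for the character module and `c = ht p`. Since `Ext^k(G, T⁺)` is dual
to `Tor_k(T, G)`, it suffices to kill the former (`isZero_tor_of_extVanishes`). The functor `X ↦
Hom(X, E)⁺` is exact and preserves injectives over a noetherian ring, so `T⁺` inherits finite
injective dimension from `D`. Dimension shifting along the complete resolution, leftwards for `k <
c` and rightwards for `k > c`, then reduces the claim from `G` to injective modules `I`
(`IsCompleteInjectiveResolution.extVanishes_range`).

Elements outside `p` act invertibly on `E`, so the case of `I` can be treated over `R_p`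
(`HomCharacter.extVanishes_of_injective`). There a regular sequence `rs` of length `c = dim R_p`
exists. As `T` is torsion for each element of `rs`, `I = Hom(R_p, I)` may be replaced by modules
killed by `rs` (`extVanishes_linearMap_of_isWeaklyRegular`). For these, `k < c` is excluded because
`rs` is regular on `T⁺`, and `k > c` because they are built from the residue field, which embeds in
`R_p/(rs)`, a module of projective dimension `c` (`ExtVanishes.of_length_lt`). -/

/-! ### Vanishing of Ext and dimension shifting -/

section ExtVanishing

open Abelian

variable {R : Type u} [CommRing R]

/-- `Ext^k_R(M, N) = 0`. -/
def ExtVanishes (R : Type u) [CommRing R] (M N : Type u) [AddCommGroup M] [Module R M]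
    [AddCommGroup N] [Module R N] (k : ℕ) : Prop :=
  Subsingleton (Ext (ModuleCat.of R M) (ModuleCat.of R N) k)

variable {A B C M N Q : Type u} [AddCommGroup A] [Module R A] [AddCommGroup B] [Module R B]
  [AddCommGroup C] [Module R C] [AddCommGroup M] [Module R M] [AddCommGroup N] [Module R N]
  [AddCommGroup Q] [Module R Q]

/-- The short complex in `ModuleCat` attached to an exact pair of linear maps. -/
abbrev exactPairShortComplex (f : A →ₗ[R] B) (g : B →ₗ[R] C) (h : Function.Exact f g) :
    ShortComplex (ModuleCat.{u} R) :=
  ModuleCat.shortComplexOfCompEqZero f g h.linearMap_comp_eq_zero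

lemma exactPairShortComplex_shortExact {f : A →ₗ[R] B} {g : B →ₗ[R] C}
    (hf : Function.Injective f) (h : Function.Exact f g) (hg : Function.Surjective g) :
    (exactPairShortComplex f g h).ShortExact where
  exact := ModuleCat.shortComplex_exact _ h
  mono_f := (ModuleCat.mono_iff_injective _).2 hf
  epi_g := (ModuleCat.epi_iff_surjective _).2 hg

lemma extVanishes_iff {k : ℕ} : ExtVanishes R M N k ↔
    ∀ x : Ext (ModuleCat.of R M) (ModuleCat.of R N) k, x = 0 :=
  ⟨fun h x => h.elim x 0, fun h => ⟨fun x y => (h x).trans (h y).symm⟩⟩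

lemma extVanishes_zero_iff : ExtVanishes R M N 0 ↔ Subsingleton (M →ₗ[R] N) :=
  (Ext.addEquiv₀.trans ModuleCat.homAddEquiv).toEquiv.subsingleton_congr

lemma ExtVanishes.congr_left (e : M ≃ₗ[R] N) {k : ℕ} (h : ExtVanishes R M Q k) :
    ExtVanishes R N Q k := by
  rw [extVanishes_iff] at h ⊢
  intro x
  have h1 := h ((Ext.mk₀ e.toModuleIso.hom).comp x (zero_add k))
  have h2 : (Ext.mk₀ e.toModuleIso.inv).comp
      ((Ext.mk₀ e.toModuleIso.hom).comp x (zero_add k)) (zero_add k) = x := by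
    rw [← Ext.comp_assoc_of_second_deg_zero, Ext.mk₀_comp_mk₀, Iso.inv_hom_id, Ext.mk₀_id_comp]
  rw [← h2, h1, Ext.comp_zero]

lemma ExtVanishes.congr_right (e : M ≃ₗ[R] N) {k : ℕ} (h : ExtVanishes R Q M k) :
    ExtVanishes R Q N k := by
  rw [extVanishes_iff] at h ⊢
  intro x
  have h1 := h (x.comp (Ext.mk₀ e.toModuleIso.inv) (add_zero k))
  have h2 : (x.comp (Ext.mk₀ e.toModuleIso.inv) (add_zero k)).comp
      (Ext.mk₀ e.toModuleIso.hom) (add_zero k) = x := by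
    rw [Ext.comp_assoc_of_second_deg_zero, Ext.mk₀_comp_mk₀, Iso.inv_hom_id, Ext.comp_mk₀_id]
  rw [← h2, h1, Ext.zero_comp]

lemma ExtVanishes.of_subsingleton_left [Subsingleton M] (k : ℕ) : ExtVanishes R M N k := by
  rw [extVanishes_iff]
  intro x
  have h : (𝟙 (ModuleCat.of R M)) = 0 := by
    ext y
    exact Subsingleton.elim (α := M) _ _
  rw [← Ext.mk₀_id_comp x, h, Ext.mk₀_zero, Ext.zero_comp]

lemma ExtVanishes.of_projective [Module.Projective R M] (k : ℕ) : ExtVanishes R M N (k + 1) := by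
  have := (IsProjective.iff_projective (R := R) M).1 ‹_›
  rw [extVanishes_iff]
  intro x
  exact Ext.eq_zero_of_projective x

lemma ExtVanishes.of_injective (h : Module.Injective R N) (k : ℕ) : ExtVanishes R M N (k + 1) := by
  have := (Module.injective_iff_injective_object R N).1 h
  rw [extVanishes_iff]
  intro x
  exact Ext.eq_zero_of_injective x

section Sequences

variable {f : A →ₗ[R] B} {g : B →ₗ[R] C}

lemma ExtVanishes.contravariant_mid (hf : Function.Injective f) (h : Function.Exact f g)
    (hg : Function.Surjective g) {k : ℕ} (hA : ExtVanishes R A Q k)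
    (hC : ExtVanishes R C Q k) : ExtVanishes R B Q k := by
  rw [extVanishes_iff] at *
  intro x
  obtain ⟨y, rfl⟩ := Ext.contravariant_sequence_exact₂
    (exactPairShortComplex_shortExact hf h hg) (ModuleCat.of R Q) x (hA _)
  rw [hC y, Ext.comp_zero]

lemma ExtVanishes.contravariant_left (hf : Function.Injective f) (h : Function.Exact f g)
    (hg : Function.Surjective g) {k : ℕ} (hB : ExtVanishes R B Q k)
    (hC : ExtVanishes R C Q (k + 1)) : ExtVanishes R A Q k := by
  rw [extVanishes_iff] at *
  intro x
  obtain ⟨y, rfl⟩ := Ext.contravariant_sequence_exact₁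
    (exactPairShortComplex_shortExact hf h hg) (ModuleCat.of R Q) x (add_comm 1 k) (hC _)
  rw [hB y, Ext.comp_zero]

lemma ExtVanishes.contravariant_right (hf : Function.Injective f) (h : Function.Exact f g)
    (hg : Function.Surjective g) {k : ℕ} (hA : ExtVanishes R A Q k)
    (hB : ExtVanishes R B Q (k + 1)) : ExtVanishes R C Q (k + 1) := by
  rw [extVanishes_iff] at *
  intro x
  obtain ⟨y, rfl⟩ := Ext.contravariant_sequence_exact₃
    (exactPairShortComplex_shortExact hf h hg) (ModuleCat.of R Q) x (hB _) (add_comm 1 k)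
  rw [hA y, Ext.comp_zero]

lemma ExtVanishes.covariant_right (hf : Function.Injective f) (h : Function.Exact f g)
    (hg : Function.Surjective g) {k : ℕ} (hB : ExtVanishes R Q B k)
    (hA : ExtVanishes R Q A (k + 1)) : ExtVanishes R Q C k := by
  rw [extVanishes_iff] at *
  intro x
  obtain ⟨y, rfl⟩ := Ext.covariant_sequence_exact₃ (ModuleCat.of R Q)
    (exactPairShortComplex_shortExact hf h hg) x rfl (hA _)
  rw [hB y, Ext.zero_comp]

lemma ExtVanishes.covariant_left (hf : Function.Injective f) (h : Function.Exact f g)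
    (hg : Function.Surjective g) {k : ℕ} (hB : ExtVanishes R Q B (k + 1))
    (hC : ExtVanishes R Q C k) : ExtVanishes R Q A (k + 1) := by
  rw [extVanishes_iff] at *
  intro x
  obtain ⟨y, rfl⟩ := Ext.covariant_sequence_exact₁ (ModuleCat.of R Q)
    (exactPairShortComplex_shortExact hf h hg) x (hB _) rfl
  rw [hC y, Ext.zero_comp]

lemma ExtVanishes.exists_lift (hf : Function.Injective f) (h : Function.Exact f g)
    (hg : Function.Surjective g) (hA : ExtVanishes R Q A 1) (φ : Q →ₗ[R] C) :
    ∃ ψ : Q →ₗ[R] B, g ∘ₗ ψ = φ := by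
  rw [extVanishes_iff] at hA
  obtain ⟨y, hy⟩ := Ext.covariant_sequence_exact₃ (ModuleCat.of R Q)
    (exactPairShortComplex_shortExact hf h hg) (Ext.mk₀ (ModuleCat.ofHom φ)) (zero_add 1) (hA _)
  obtain ⟨ψ, rfl⟩ := Ext.mk₀_bijective _ _ |>.2 y
  refine ⟨ψ.hom, ?_⟩
  rw [Ext.mk₀_comp_mk₀] at hy
  have := (Ext.mk₀_bijective _ _).1 hy
  exact congrArg ModuleCat.Hom.hom this

lemma ExtVanishes.exists_extension (hf : Function.Injective f) (h : Function.Exact f g)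
    (hg : Function.Surjective g) (hC : ExtVanishes R C Q 1) (φ : A →ₗ[R] Q) :
    ∃ ψ : B →ₗ[R] Q, ψ ∘ₗ f = φ := by
  rw [extVanishes_iff] at hC
  obtain ⟨y, hy⟩ := Ext.contravariant_sequence_exact₁
    (exactPairShortComplex_shortExact hf h hg) (ModuleCat.of R Q) (Ext.mk₀ (ModuleCat.ofHom φ))
    (add_zero 1) (hC _)
  obtain ⟨ψ, rfl⟩ := Ext.mk₀_bijective _ _ |>.2 y
  refine ⟨ψ.hom, ?_⟩
  rw [Ext.mk₀_comp_mk₀] at hy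
  have := (Ext.mk₀_bijective _ _).1 hy
  exact congrArg ModuleCat.Hom.hom this

/-- Base case of the later dimension shifts: with a projective middle term, `Ext^1` is the
obstruction to extending maps. -/
lemma ExtVanishes.one_of_exists_extension (hf : Function.Injective f) (h : Function.Exact f g)
    (hg : Function.Surjective g) (hB : ExtVanishes R B Q 1)
    (hext : ∀ φ : A →ₗ[R] Q, ∃ ψ : B →ₗ[R] Q, ψ ∘ₗ f = φ) : ExtVanishes R C Q 1 := by
  rw [extVanishes_iff] at *
  intro x
  obtain ⟨y, rfl⟩ := Ext.contravariant_sequence_exact₃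
    (exactPairShortComplex_shortExact hf h hg) (ModuleCat.of R Q) x (hB _) (add_zero 1)
  obtain ⟨φ, rfl⟩ := Ext.mk₀_bijective _ _ |>.2 y
  obtain ⟨ψ, hψ⟩ := hext φ.hom
  have : φ = (exactPairShortComplex f g h).f ≫ ModuleCat.ofHom ψ := by
    ext1
    exact hψ.symm
  rw [this, ← Ext.mk₀_comp_mk₀, ← Ext.comp_assoc_of_third_deg_zero,
    ShortComplex.ShortExact.extClass_comp, Ext.zero_comp]

end Sequences

lemma ExtVanishes.zero_of_surjective {g : B →ₗ[R] C} (hg : Function.Surjective g)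
    (hB : ExtVanishes R B Q 0) : ExtVanishes R C Q 0 := by
  rw [extVanishes_zero_iff] at *
  refine ⟨fun φ ψ => ?_⟩
  have := hB.elim (φ ∘ₗ g) (ψ ∘ₗ g)
  exact (LinearMap.cancel_right hg).1 this

lemma LinearMap.exact_ker_subtype (g : B →ₗ[R] C) :
    Function.Exact (LinearMap.ker g).subtype g := by
  rw [LinearMap.exact_iff, Submodule.range_subtype]

lemma exists_free_presentation (R : Type u) [CommRing R] (M : Type u) [AddCommGroup M]
    [Module R M] : ∃ (K F : Type u) (_ : AddCommGroup K) (_ : Module R K) (_ : AddCommGroup F)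
      (_ : Module R F) (_ : Module.Free R F) (i : K →ₗ[R] F) (g : F →ₗ[R] M),
      Function.Injective i ∧ Function.Exact i g ∧ Function.Surjective g := by
  have hg := Finsupp.linearCombination_id_surjective R M
  generalize Finsupp.linearCombination R (id : M → M) = g at hg
  exact ⟨LinearMap.ker g, M →₀ R, inferInstance, inferInstance, inferInstance, inferInstance,
    inferInstance, (LinearMap.ker g).subtype, g, Submodule.subtype_injective _,
    LinearMap.exact_ker_subtype g, hg⟩

lemma exists_finite_free_presentation (R : Type u) [CommRing R] [IsNoetherianRing R] (M : Type u)
    [AddCommGroup M] [Module R M] [Module.Finite R M] :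
    ∃ (K F : Type u) (_ : AddCommGroup K) (_ : Module R K) (_ : AddCommGroup F)
      (_ : Module R F) (_ : Module.Finite R K) (_ : Module.Free R F) (_ : Module.Finite R F)
      (i : K →ₗ[R] F) (g : F →ₗ[R] M),
      Function.Injective i ∧ Function.Exact i g ∧ Function.Surjective g := by
  obtain ⟨F, _, _, _, _, g, hg⟩ := Module.exists_finite_presentation R M
  exact ⟨LinearMap.ker g, F, inferInstance, inferInstance, _, _, inferInstance, inferInstance,
    inferInstance, (LinearMap.ker g).subtype, g, Submodule.subtype_injective _,
    LinearMap.exact_ker_subtype g, hg⟩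

/-- Multiplication by `x` on `Ext^k(M, N)` is surjective. -/
def ExtDivisible (R : Type u) [CommRing R] (M N : Type u) [AddCommGroup M] [Module R M]
    [AddCommGroup N] [Module R N] (k : ℕ) (x : R) : Prop :=
  Function.Surjective fun e : Ext (ModuleCat.of R M) (ModuleCat.of R N) k => x • e

end ExtVanishing

/-! ### Character modules and the functor `Hom(-, E)⁺` -/

section Duality

/-- `φ` descends to `A / ker β`, which embeds in `B`. The Baer form leaves universes free, so that
`ℚ/ℤ` is allowed as `E`. -/
lemma Module.Baer.exists_factor {R : Type*} [CommRing R] {A B E : Type*} [AddCommGroup A]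
    [Module R A] [AddCommGroup B] [Module R B] [AddCommGroup E] [Module R E] (hE : Module.Baer R E)
    (β : A →ₗ[R] B) (φ : A →ₗ[R] E) (h : LinearMap.ker β ≤ LinearMap.ker φ) :
    ∃ ψ : B →ₗ[R] E, ψ ∘ₗ β = φ := by
  obtain ⟨ψ, hψ⟩ := hE.extension_property ((LinearMap.ker β).liftQ β le_rfl)
    (LinearMap.ker_eq_bot.1 (Submodule.ker_liftQ_eq_bot _ _ _ le_rfl))
    ((LinearMap.ker β).liftQ φ h)
  refine ⟨ψ, ?_⟩
  ext a
  simpa using LinearMap.congr_fun hψ (Submodule.Quotient.mk a)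

lemma Function.Exact.characterModule_dual {R : Type*} [CommRing R] {A B C : Type*} [AddCommGroup A]
    [Module R A] [AddCommGroup B] [Module R B] [AddCommGroup C] [Module R C]
    {f : A →ₗ[R] B} {g : B →ₗ[R] C} (h : Function.Exact f g) :
    Function.Exact (CharacterModule.dual g) (CharacterModule.dual f) := by
  intro c
  constructor
  · intro hc
    obtain ⟨ψ, hψ⟩ := (Module.Baer.of_divisible (AddCircle (1 : ℚ))).exists_factor
      g.toAddMonoidHom.toIntLinearMap (AddMonoidHom.toIntLinearMap c) (by
        intro b hb
        obtain ⟨a, rfl⟩ := (h b).1 hb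
        exact DFunLike.congr_fun hc a)
    refine ⟨ψ.toAddMonoidHom, ?_⟩
    ext b
    exact LinearMap.congr_fun hψ b
  · rintro ⟨d, rfl⟩
    ext a
    change d (g (f a)) = 0
    rw [h.apply_apply_eq_zero]
    exact map_zero (d : _ →+ _)

variable {R : Type u} [CommRing R]

/-- Equational criterion: given `∑ f i • x i = 0`, let the rows of `β` be finitely many generators
of the syzygies of `f`. If `β v = 0`, injectivity of `I` gives `u` with `v i = f i • u`, so `∑ x i
(v i) = 0`. Thus `X` factors through `β` by injectivity of `E`, and the factor trivializes the
relation. -/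
lemma Module.Injective.flat_linearMap [IsNoetherianRing R] {I E : Type u} [AddCommGroup I]
    [Module R I] [AddCommGroup E] [Module R E] (hI : Module.Injective R I)
    (hE : Module.Injective R E) : Module.Flat R (I →ₗ[R] E) := by
  refine Module.Flat.of_forall_isTrivialRelation fun {l f x} hfx => ?_
  let r : (Fin l → R) →ₗ[R] R := Fintype.linearCombination R f
  obtain ⟨k, w, hw⟩ := Submodule.fg_iff_exists_fin_generating_family.1
    (IsNoetherian.noetherian (LinearMap.ker r))
  let β : (Fin l → I) →ₗ[R] (Fin k → I) :=
    LinearMap.pi fun j => ∑ i, w j i • LinearMap.proj i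
  let X : (Fin l → I) →ₗ[R] E := ∑ i, x i ∘ₗ LinearMap.proj i
  have hβ : LinearMap.ker β ≤ LinearMap.ker X := by
    intro v hv
    let h : (Fin l → R) →ₗ[R] I := Fintype.linearCombination R v
    have hk : LinearMap.ker r ≤ LinearMap.ker h := by
      rw [← hw, Submodule.span_le]
      rintro _ ⟨j, rfl⟩
      have := congrFun (LinearMap.mem_ker.1 hv) j
      simpa [β, h, Fintype.linearCombination_apply] using this
    obtain ⟨g, hg⟩ := (Module.Baer.of_injective hI).exists_factor r h hk
    have hvi (i : Fin l) : v i = f i • g 1 := by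
      have := LinearMap.congr_fun hg (Pi.single i 1)
      simp only [LinearMap.comp_apply, r, h, Fintype.linearCombination_apply_single,
        one_smul] at this
      rw [← this, ← map_smul, smul_eq_mul, mul_one]
    have := LinearMap.congr_fun hfx (g 1)
    simp only [LinearMap.sum_apply, LinearMap.smul_apply, LinearMap.zero_apply] at this
    simpa [X, hvi] using this
  obtain ⟨Y, hY⟩ := (Module.Baer.of_injective hE).exists_factor β X hβ
  refine ⟨k, fun i j => w j i,
    fun j => Y ∘ₗ LinearMap.single R (fun _ => I) j, fun i => ?_, fun j => ?_⟩
  · ext e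
    have h1 := LinearMap.congr_fun hY (Pi.single i e)
    have h2 : X (Pi.single i e) = x i e := by
      simp only [X, LinearMap.sum_apply, LinearMap.comp_apply, LinearMap.proj_apply]
      rw [Finset.sum_eq_single i] <;> simp +contextual
    have h3 : β (Pi.single i e) = ∑ j, Pi.single j (w j i • e) := by
      ext j
      simp only [β, LinearMap.pi_apply, LinearMap.sum_apply, LinearMap.smul_apply,
        LinearMap.proj_apply, Finset.sum_apply]
      rw [Finset.sum_eq_single i, Finset.sum_eq_single j] <;> simp +contextual [eq_comm]
    rw [← h2, ← h1, LinearMap.comp_apply, h3, map_sum, LinearMap.sum_apply]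
    refine Finset.sum_congr rfl fun j _ => ?_
    rw [LinearMap.smul_apply, LinearMap.comp_apply, ← map_smul, LinearMap.single_apply,
      Pi.single_smul]
  · have : w j ∈ LinearMap.ker r := hw ▸ Submodule.subset_span ⟨j, rfl⟩
    simpa [r, Fintype.linearCombination_apply, mul_comm] using this

/-- The covariant functor `X ↦ Hom_R(X, E)⁺`, where `(-)⁺` is the character module. -/
abbrev HomCharacter (E X : Type u) [AddCommGroup E] [Module R E] [AddCommGroup X] [Module R X] :
    Type u :=
  CharacterModule (X →ₗ[R] E)

namespace HomCharacter

variable (E : Type u) {X Y Z : Type u} [AddCommGroup E] [Module R E] [AddCommGroup X] [Module R X]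
  [AddCommGroup Y] [Module R Y] [AddCommGroup Z] [Module R Z]

/-- The action of `HomCharacter` on linear maps. -/
noncomputable def map (f : X →ₗ[R] Y) : HomCharacter (R := R) E X →ₗ[R] HomCharacter (R := R) E Y :=
  CharacterModule.dual (LinearMap.lcomp R E f)

@[simp] lemma map_apply (f : X →ₗ[R] Y) (c : HomCharacter (R := R) E X) (φ : Y →ₗ[R] E) :
    map E f c φ = c (φ ∘ₗ f) := rfl

variable {E}

lemma map_injective (hE : Module.Injective R E) {f : X →ₗ[R] Y}
    (hf : Function.Injective f) : Function.Injective (map E f) := by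
  refine CharacterModule.dual_injective_of_surjective _ fun φ => ?_
  exact Module.Injective.extension_property R _ _ _ f hf φ

lemma map_surjective {f : X →ₗ[R] Y} (hf : Function.Surjective f) :
    Function.Surjective (map E f) := by
  refine CharacterModule.dual_surjective_of_injective _ fun φ ψ h => ?_
  exact (LinearMap.cancel_right hf).1 h

lemma map_exact (hE : Module.Injective R E) {f : X →ₗ[R] Y} {g : Y →ₗ[R] Z}
    (h : Function.Exact f g) : Function.Exact (map E f) (map E g) := by
  refine Function.Exact.characterModule_dual fun φ => ⟨fun hφ => ?_, ?_⟩
  · refine (Module.Baer.of_injective hE).exists_factor g φ fun y hy => ?_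
    obtain ⟨x, rfl⟩ := (h y).1 hy
    exact LinearMap.congr_fun hφ x
  · rintro ⟨ψ, rfl⟩
    ext x
    simp [h.apply_apply_eq_zero]

lemma injective (hE : Module.Injective R E) [IsNoetherianRing R] (hX : Module.Injective R X) :
    Module.Injective R (HomCharacter (R := R) E X) :=
  have := hX.flat_linearMap hE
  Module.Flat.iff_characterModule_injective.1 this

/-- The functor carries an injective coresolution of `X` to one of `Hom(X, E)⁺`. -/
lemma extVanishes_of_hasInjectiveDimensionLE (hE : Module.Injective R E)
    [IsNoetherianRing R] {n : ℕ}
    (hX : HasInjectiveDimensionLE (ModuleCat.of R X) n) {k : ℕ} (hk : n < k) (M : Type u)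
    [AddCommGroup M] [Module R M] : ExtVanishes R M (HomCharacter (R := R) E X) k := by
  induction n generalizing X k with
  | zero =>
    have h1 : Injective (ModuleCat.of R X) := by
      simpa only [HasInjectiveDimensionLE, zero_add, ← injective_iff_hasInjectiveDimensionLT_one]
        using hX
    have h2 := (Module.injective_iff_injective_object R X).2 h1
    obtain ⟨k, rfl⟩ := Nat.exists_eq_succ_of_ne_zero hk.ne'
    exact .of_injective (injective hE h2) k
  | succ n ih =>
    obtain ⟨I, hI, f, hf⟩ :=
      (inferInstance : EnoughInjectives (ModuleCat.{u} R)).1 (ModuleCat.of R X)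
    have hfi : Function.Injective f.hom := (ModuleCat.mono_iff_injective _).1 hf
    have hex : Function.Exact f.hom (LinearMap.range f.hom).mkQ := by
      rw [LinearMap.exact_iff, Submodule.ker_mkQ]
    have hs := (LinearMap.range f.hom).mkQ_surjective
    have hse := exactPairShortComplex_shortExact hfi hex hs
    have hC := (hse.hasInjectiveDimensionLT_X₃_iff n hI).2 hX
    obtain ⟨k, rfl⟩ := Nat.exists_eq_succ_of_ne_zero (Nat.ne_zero_of_lt hk)
    obtain ⟨k, rfl⟩ := Nat.exists_eq_succ_of_ne_zero (n := k) (by lia)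
    exact .covariant_left (map_injective hE hfi) (map_exact hE hex) (map_surjective hs)
      (.of_injective (injective hE ((Module.injective_iff_injective_object R I).2 hI)) _)
      (ih hC (by lia))

open RingTheory.Sequence Pointwise in
lemma isWeaklyRegular (hE : Module.Injective R E) {rs : List R} (h : IsWeaklyRegular X rs) :
    IsWeaklyRegular (HomCharacter (R := R) E X) rs := by
  induction rs generalizing X with
  | nil => simp
  | cons x rs ih =>
    rw [isWeaklyRegular_cons_iff] at h ⊢
    have hmap :
        map E (LinearMap.lsmul R X x) = LinearMap.lsmul R (HomCharacter (R := R) E X) x := by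
      ext c φ
      simp only [map_apply, LinearMap.lsmul_apply, CharacterModule.smul_apply]
      congr 1
      ext y
      simp
    refine ⟨?_, ?_⟩
    · have := map_injective hE (f := LinearMap.lsmul R X x) h.1
      rwa [hmap] at this
    · have hex := map_exact hE (LinearMap.exact_lsmul_mkQ_smul_top X x)
      rw [hmap] at hex
      have hk : LinearMap.ker (map E (x • (⊤ : Submodule R X)).mkQ) =
          x • (⊤ : Submodule R (HomCharacter (R := R) E X)) := by
        rw [LinearMap.exact_iff.1 hex]
        ext c
        simp [Submodule.mem_smul_pointwise_iff_exists]
      let e : QuotSMulTop x (HomCharacter (R := R) E X) ≃ₗ[R]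
          HomCharacter (R := R) E (QuotSMulTop x X) :=
        (Submodule.quotEquivOfEq _ _ hk.symm).trans
          (LinearMap.quotKerEquivOfSurjective _ (map_surjective (Submodule.mkQ_surjective _)))
      exact (e.isWeaklyRegular_congr rs).2 (ih h.2)

end HomCharacter

end Duality

/-! ### Regular sequences acting on Ext -/

section RegularSequences

open Abelian RingTheory.Sequence Pointwise

variable {R : Type u} [CommRing R] {M N Q T : Type u} [AddCommGroup M] [Module R M]
  [AddCommGroup N] [Module R N] [AddCommGroup Q] [Module R Q] [AddCommGroup T] [Module R T]

lemma mk₀_lsmul_comp (x : R) {k : ℕ} (e : Ext (ModuleCat.of R M) (ModuleCat.of R Q) k) :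
    (Ext.mk₀ (ModuleCat.ofHom (LinearMap.lsmul R M x))).comp e (zero_add k) = x • e := by
  have : ModuleCat.ofHom (LinearMap.lsmul R M x) = x • 𝟙 (ModuleCat.of R M) := rfl
  rw [this, Ext.mk₀_smul, Ext.smul_comp, Ext.mk₀_id_comp]

lemma comp_mk₀_lsmul (x : R) {k : ℕ} (e : Ext (ModuleCat.of R M) (ModuleCat.of R Q) k) :
    e.comp (Ext.mk₀ (ModuleCat.ofHom (LinearMap.lsmul R Q x))) (add_zero k) = x • e := by
  rw [Ext.smul_eq_comp_mk₀]
  rfl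

lemma ext_smul_eq_zero {x : R} (hx : ∀ m : M, x • m = 0) {k : ℕ}
    (e : Ext (ModuleCat.of R M) (ModuleCat.of R Q) k) : x • e = 0 := by
  have : LinearMap.lsmul R M x = 0 := LinearMap.ext hx
  rw [← mk₀_lsmul_comp, this, ModuleCat.ofHom_zero, Ext.mk₀_zero, Ext.zero_comp]

lemma IsSMulRegular.linearMap_injective {x : R} (h : IsSMulRegular Q x) :
    Function.Injective (LinearMap.lsmul R Q x) := h

/-- A module annihilated by a `Q`-regular sequence of length `d` has no `Ext^k` into `Q` for
`k < d`. -/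
lemma ExtVanishes.of_isWeaklyRegular {rs : List R} (h : IsWeaklyRegular Q rs)
    (hM : ∀ r ∈ rs, ∀ m : M, r • m = 0) {k : ℕ} (hk : k < rs.length) : ExtVanishes R M Q k := by
  induction rs generalizing Q k with
  | nil => simp at hk
  | cons x rs ih =>
    rw [isWeaklyRegular_cons_iff] at h
    have hx : ∀ m : M, x • m = 0 := hM x (by simp)
    cases k with
    | zero =>
      rw [extVanishes_zero_iff]
      refine ⟨fun f g => LinearMap.ext fun m => h.1 ?_⟩
      simp only [← map_smul, hx, map_zero]
    | succ k =>
      have h1 := ih h.2 (fun r hr => hM r (by simp [hr])) (Nat.lt_of_succ_lt_succ hk)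
      rw [extVanishes_iff] at h1 ⊢
      intro e
      -- `x` kills `M`, hence `e`, so `e` comes from `Ext^k(M, Q/xQ)`.
      obtain ⟨y, rfl⟩ := Ext.covariant_sequence_exact₁ (ModuleCat.of R M)
        (exactPairShortComplex_shortExact h.1.linearMap_injective
          (LinearMap.exact_lsmul_mkQ_smul_top Q x) (Submodule.mkQ_surjective _)) e
        ((comp_mk₀_lsmul x e).trans (ext_smul_eq_zero hx e)) rfl
      exact (congrArg (fun z => Ext.comp z _ _) (h1 y)).trans (Ext.zero_comp ..)

lemma ExtDivisible.pow {k : ℕ} {x : R} (h : ExtDivisible R M N k x) (n : ℕ)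
    (e : Ext (ModuleCat.of R M) (ModuleCat.of R N) k) :
    ∃ e' : Ext (ModuleCat.of R M) (ModuleCat.of R N) k, x ^ n • e' = e := by
  induction n with
  | zero => exact ⟨e, by simp⟩
  | succ n ih =>
    obtain ⟨e', rfl⟩ := ih
    obtain ⟨e'', rfl⟩ := h e'
    exact ⟨e'', by simp [pow_succ, mul_smul]⟩

open TensorProduct in
-- By adjunction `φ` is a character of `K ⊗ T`, and it extends once it kills `ker (i ⊗ T)`. An
-- element `z` of this kernel is killed by some `x ^ n`, so both summands of `φ = x ^ n • φ' + ψ ∘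
-- i` vanish on it.
lemma exists_extension_of_forall_pow {K F : Type u} [AddCommGroup K] [Module R K] [AddCommGroup F]
    [Module R F] (i : K →ₗ[R] F) {x : R} (hT : ∀ t : T, ∃ n : ℕ, x ^ n • t = 0)
    (φ : K →ₗ[R] CharacterModule T)
    (h : ∀ n : ℕ, ∃ (φ' : K →ₗ[R] CharacterModule T) (ψ : F →ₗ[R] CharacterModule T),
      φ = x ^ n • φ' + ψ ∘ₗ i) : ∃ ψ : F →ₗ[R] CharacterModule T, ψ ∘ₗ i = φ := by
  let c : CharacterModule (K ⊗[R] T) := CharacterModule.uncurry φ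
  have hc : ∀ z : K ⊗[R] T, i.rTensor T z = 0 → c z = 0 := by
    intro z hz
    obtain ⟨n, hn⟩ : ∃ n : ℕ, x ^ n • z = 0 := by
      clear hz
      induction z with
      | zero => exact ⟨0, by simp⟩
      | tmul a t =>
        obtain ⟨n, hn⟩ := hT t
        exact ⟨n, by rw [← TensorProduct.tmul_smul, hn, TensorProduct.tmul_zero]⟩
      | add a b ha hb =>
        obtain ⟨n, hn⟩ := ha
        obtain ⟨m, hm⟩ := hb
        refine ⟨n + m, ?_⟩
        rw [smul_add, pow_add, mul_smul (x ^ n), mul_smul, hm, smul_zero, add_zero,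
          smul_comm, hn, smul_zero]
    obtain ⟨φ', ψ, rfl⟩ := h n
    have h1 : c = x ^ n • CharacterModule.uncurry φ' +
        CharacterModule.dual (i.rTensor T) (CharacterModule.uncurry ψ) := by
      simp only [c, map_add, map_smul]
      congr 1
      apply (CharacterModule.homEquiv (R := R)).symm.injective
      ext a t
      rfl
    rw [h1]
    change CharacterModule.uncurry φ' (x ^ n • z) + CharacterModule.uncurry ψ (i.rTensor T z) = 0
    rw [hn, hz]
    exact (congrArg₂ (· + ·) (map_zero (CharacterModule.uncurry φ' : _ →+ _))
      (map_zero (CharacterModule.uncurry ψ : _ →+ _))).trans (add_zero 0)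
  obtain ⟨d, hd⟩ := (Module.Baer.of_divisible (AddCircle (1 : ℚ))).exists_factor
    (i.rTensor T).toAddMonoidHom.toIntLinearMap (AddMonoidHom.toIntLinearMap c) hc
  refine ⟨CharacterModule.curry (d.toAddMonoidHom : CharacterModule (F ⊗[R] T)), ?_⟩
  ext a t
  exact LinearMap.congr_fun hd (a ⊗ₜ t)

/-- If every element of `T` is killed by a power of `x`, then `Ext^k(M, T⁺)` has no nonzero
`x`-divisible quotient: it vanishes as soon as it is `x`-divisible. -/
lemma ExtVanishes.of_extDivisible {x : R} (hT : ∀ t : T, ∃ n : ℕ, x ^ n • t = 0) {k : ℕ}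
    (h : ExtDivisible R M (CharacterModule T) k x) : ExtVanishes R M (CharacterModule T) k := by
  -- Conceptually, `Ext^k(M, T⁺)` is dual to `Tor_k(M, T)`, which is `x`-torsion; divisibility of
  -- the dual makes `x` injective on it, so it is zero.
  induction k generalizing M with
  | zero =>
    rw [extVanishes_iff]
    intro e
    obtain ⟨φ, rfl⟩ := (Ext.linearEquiv₀ (R := R)).symm.surjective e
    have : φ = 0 := by
      ext m t
      obtain ⟨n, hn⟩ := hT t
      obtain ⟨e', he'⟩ := h.pow n ((Ext.linearEquiv₀ (R := R)).symm φ)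
      obtain ⟨φ', rfl⟩ := (Ext.linearEquiv₀ (R := R)).symm.surjective e'
      rw [← map_smul] at he'
      rw [← (Ext.linearEquiv₀ (R := R)).symm.injective he']
      change φ'.hom m (x ^ n • t) = 0
      rw [hn, map_zero]
    rw [this, map_zero]
  | succ k ih =>
    obtain ⟨K, F, _, _, _, _, _, i, g, hi, hex, hg⟩ := exists_free_presentation R M
    have hse := exactPairShortComplex_shortExact hi hex hg
    cases k with
    -- The connecting map `Hom(K, T⁺) → Ext^1(M, T⁺)` need not be injective, so divisibility lifts
    -- to `K` only modulo maps that extend to `F`.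
    | zero =>
      refine .one_of_exists_extension hi hex hg (.of_projective 0) fun φ =>
        exists_extension_of_forall_pow _ hT φ fun n => ?_
      obtain ⟨e', he'⟩ := h.pow n (hse.extClass.comp (Ext.mk₀ (ModuleCat.ofHom φ)) (add_zero 1))
      obtain ⟨y, rfl⟩ := Ext.contravariant_sequence_exact₃ hse _ e'
        (extVanishes_iff.1 (.of_projective 0) _) (add_zero 1)
      obtain ⟨φ', rfl⟩ := (Ext.mk₀_bijective _ _).2 y
      rw [← Ext.comp_smul, ← Ext.mk₀_smul, ← sub_eq_zero, sub_eq_add_neg, ← Ext.comp_neg,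
        ← Ext.comp_add, ← Ext.mk₀_neg, ← Ext.mk₀_add] at he'
      obtain ⟨y, hy⟩ := Ext.contravariant_sequence_exact₁ hse _ _ (add_zero 1) he'
      obtain ⟨ψ, rfl⟩ := (Ext.mk₀_bijective _ _).2 y
      rw [Ext.mk₀_comp_mk₀] at hy
      have := congrArg ModuleCat.Hom.hom ((Ext.mk₀_bijective _ _).1 hy)
      refine ⟨φ'.hom, -ψ.hom, ?_⟩
      have h2 : ψ.hom ∘ₗ i = x ^ n • φ'.hom + -φ := this
      rw [LinearMap.neg_comp, h2]
      abel
    | succ k =>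
      refine .contravariant_right hi hex hg (ih fun e => ?_) (.of_projective _)
      obtain ⟨e', he'⟩ := h (hse.extClass.comp e (add_comm 1 (k + 1)))
      obtain ⟨y, rfl⟩ := Ext.contravariant_sequence_exact₃ hse _ e'
        (extVanishes_iff.1 (.of_projective _) _) (add_comm 1 (k + 1))
      refine ⟨y, ?_⟩
      simp only at he' ⊢
      rw [← Ext.comp_smul, ← sub_eq_zero, sub_eq_add_neg, ← Ext.comp_neg, ← Ext.comp_add] at he'
      obtain ⟨z, hz⟩ := Ext.contravariant_sequence_exact₁ hse _ _ (add_comm 1 (k + 1)) he'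
      rw [extVanishes_iff.1 (.of_projective _) z, Ext.comp_zero] at hz
      exact sub_eq_zero.1 ((sub_eq_add_neg _ _).trans hz.symm)

/-- For `x` regular on `B`, the sequence `0 → Hom(B/xB, I) → Hom(B, I) → Hom(B, I) → 0` with second
map `x` is exact. Vanishing for the first term makes `Ext^k(Hom(B, I), T⁺)` `x`-divisible, hence
zero. The annihilator clause in `h` remembers the elements already divided out. -/
lemma extVanishes_linearMap_of_isWeaklyRegular {I B : Type u} [AddCommGroup I] [Module R I]
    [AddCommGroup B] [Module R B] (hI : Module.Injective R I) {rs : List R}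
    (hB : IsWeaklyRegular B rs) (hT : ∀ r ∈ rs, ∀ t : T, ∃ n : ℕ, r ^ n • t = 0) {k : ℕ}
    (h : ∀ (M : Type u) [AddCommGroup M] [Module R M], (∀ r ∈ rs, ∀ m : M, r • m = 0) →
      (∀ r : R, (∀ b : B, r • b = 0) → ∀ m : M, r • m = 0) →
      ExtVanishes R M (CharacterModule T) k) :
    ExtVanishes R (B →ₗ[R] I) (CharacterModule T) k := by
  induction rs generalizing B with
  | nil =>
    refine h _ (by simp) fun r hr φ => ?_
    ext b
    rw [LinearMap.smul_apply, ← map_smul, hr, map_zero, LinearMap.zero_apply]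
  | cons x rs ih =>
    rw [isWeaklyRegular_cons_iff] at hB
    have h1 := ih hB.2 (fun r hr => hT r (by simp [hr])) fun M _ _ hM hann => by
      refine h M (fun r hr => ?_) (fun r hr => hann r fun b => ?_)
      · rcases List.mem_cons.1 hr with rfl | hr
        · refine hann r fun b => ?_
          obtain ⟨b, rfl⟩ := Submodule.Quotient.mk_surjective _ b
          rw [← Submodule.Quotient.mk_smul, Submodule.Quotient.mk_eq_zero]
          exact Submodule.smul_mem_pointwise_smul _ _ _ trivial
        · exact hM r hr
      · obtain ⟨b, rfl⟩ := Submodule.Quotient.mk_surjective _ b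
        rw [← Submodule.Quotient.mk_smul, hr, Submodule.Quotient.mk_zero]
    refine .of_extDivisible (hT x (by simp)) fun e => ?_
    let q := (x • (⊤ : Submodule R B)).mkQ
    have hf : Function.Injective (LinearMap.lcomp R I q) := fun φ ψ hφ =>
      (LinearMap.cancel_right (Submodule.mkQ_surjective _)).1 hφ
    have hg : Function.Surjective (LinearMap.lsmul R (B →ₗ[R] I) x) := fun φ => by
      obtain ⟨ψ, hψ⟩ := Module.Injective.extension_property R I _ _ _ hB.1.linearMap_injective φ
      refine ⟨ψ, LinearMap.ext fun b => ?_⟩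
      simpa using LinearMap.congr_fun hψ b
    have hex : Function.Exact (LinearMap.lcomp R I q) (LinearMap.lsmul R (B →ₗ[R] I) x) := by
      intro φ
      constructor
      · intro hφ
        have hle : x • (⊤ : Submodule R B) ≤ LinearMap.ker φ := by
          intro b hb
          obtain ⟨b, -, rfl⟩ := Submodule.mem_smul_pointwise_iff_exists _ _ _ |>.1 hb
          simpa using LinearMap.congr_fun hφ b
        exact ⟨(x • (⊤ : Submodule R B)).liftQ φ hle, Submodule.liftQ_mkQ _ _ hle⟩
      · rintro ⟨ψ, rfl⟩
        ext b
        change x • ψ (q b) = 0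
        have : q (x • b) = 0 := (Submodule.Quotient.mk_eq_zero _).2
          (Submodule.smul_mem_pointwise_smul b x ⊤ trivial)
        rw [← map_smul, ← map_smul, this, map_zero]
    obtain ⟨e', he'⟩ := Ext.contravariant_sequence_exact₂
      (exactPairShortComplex_shortExact hf hex hg) _ e (extVanishes_iff.1 h1 _)
    exact ⟨e', (mk₀_lsmul_comp x e').symm.trans he'⟩

end RegularSequences

/-! ### Local rings: modules killed by a maximal regular sequence, and regularity of `D` -/

section LocalRings

open Abelian RingTheory.Sequence Pointwise

variable {R : Type u} [CommRing R] {B M Q : Type u} [AddCommGroup B] [Module R B]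
  [AddCommGroup M] [Module R M] [AddCommGroup Q] [Module R Q]

/-- Each regular element raises the bound on nonvanishing degrees by one. -/
lemma ExtVanishes.quotient_of_isWeaklyRegular {rs : List R} (h : IsWeaklyRegular B rs) {c : ℕ}
    (hB : ∀ k, c < k → ExtVanishes R B Q k) {k : ℕ} (hk : c + rs.length < k) :
    ExtVanishes R (B ⧸ (Ideal.ofList rs • ⊤ : Submodule R B)) Q k := by
  induction rs generalizing B c with
  | nil =>
    refine (hB k hk).congr_left (Submodule.quotEquivOfEqBot _ ?_).symm
    simp
  | cons x rs ih =>
    rw [isWeaklyRegular_cons_iff] at h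
    have h1 : ∀ k, c + 1 < k → ExtVanishes R (QuotSMulTop x B) Q k := by
      intro k hk
      obtain ⟨k, rfl⟩ := Nat.exists_eq_succ_of_ne_zero (Nat.ne_zero_of_lt hk)
      exact .contravariant_right h.1.linearMap_injective
        (LinearMap.exact_lsmul_mkQ_smul_top B x) (Submodule.mkQ_surjective _)
        (hB k (by lia)) (hB _ (by lia))
    exact (ih h.2 h1 (by simp only [List.length_cons] at hk; lia)).congr_left
      (Submodule.quotOfListConsSMulTopEquivQuotSMulTopInner B x rs).symm

lemma isWeaklyRegular_finsupp {rs : List R} (h : IsWeaklyRegular R rs) (X : Type u) :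
    IsWeaklyRegular (X →₀ R) rs :=
  ((TensorProduct.lid R (X →₀ R)).isWeaklyRegular_congr rs).1 h.isWeaklyRegular_rTensor

/-- For the least power of the maximal ideal inside `J`, any element of the preceding power outside
`J` spans a copy of the residue field in `R ⧸ J`. -/
lemma Ideal.exists_linearMap_residueField_injective [IsLocalRing R] {J : Ideal R} (hJ : J ≠ ⊤)
    {N : ℕ} (hN : IsLocalRing.maximalIdeal R ^ N ≤ J) :
    ∃ σ : (R ⧸ IsLocalRing.maximalIdeal R) →ₗ[R] (R ⧸ J), Function.Injective σ := by
  classical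
  have hex : ∃ N, IsLocalRing.maximalIdeal R ^ N ≤ J := ⟨N, hN⟩
  obtain ⟨n, hn⟩ : ∃ n, Nat.find hex = n + 1 := by
    refine Nat.exists_eq_succ_of_ne_zero fun h0 => hJ ?_
    have := Nat.find_spec hex
    rwa [h0, pow_zero, Ideal.one_eq_top, top_le_iff] at this
  have h1 : ¬ IsLocalRing.maximalIdeal R ^ n ≤ J := Nat.find_min hex (by lia)
  have h2 : IsLocalRing.maximalIdeal R ^ (n + 1) ≤ J := hn ▸ Nat.find_spec hex
  obtain ⟨s, hs, hsJ⟩ := SetLike.not_le_iff_exists.1 h1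
  let f : R →ₗ[R] (R ⧸ J) := LinearMap.toSpanSingleton R (R ⧸ J) (Ideal.Quotient.mk J s)
  have hf (r : R) : f r = Ideal.Quotient.mk J (r * s) := by
    simp [f, Algebra.smul_def]
  have hle : IsLocalRing.maximalIdeal R ≤ LinearMap.ker f := by
    intro r hr
    rw [LinearMap.mem_ker, hf, Ideal.Quotient.eq_zero_iff_mem]
    refine h2 ?_
    rw [pow_succ']
    exact Ideal.mul_mem_mul hr hs
  have hker : LinearMap.ker f = IsLocalRing.maximalIdeal R := by
    refine le_antisymm (IsLocalRing.le_maximalIdeal fun htop => hsJ ?_) hle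
    have : (1 : R) ∈ LinearMap.ker f := htop ▸ Submodule.mem_top
    rwa [LinearMap.mem_ker, hf, one_mul, Ideal.Quotient.eq_zero_iff_mem] at this
  exact ⟨Submodule.liftQ _ f hle, LinearMap.ker_eq_bot.1 (Submodule.ker_liftQ_eq_bot _ _ _ hker.le)⟩

lemma exists_linearMap_finsupp_quotient_injective [IsLocalRing R] {J : Ideal R} (hJ : J ≠ ⊤)
    {N : ℕ} (hN : IsLocalRing.maximalIdeal R ^ N ≤ J)
    (hM : ∀ r ∈ IsLocalRing.maximalIdeal R, ∀ m : M, r • m = 0) :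
    ∃ (X : Type u) (f : M →ₗ[R] ((X →₀ R) ⧸ (J • ⊤ : Submodule R (X →₀ R)))),
      Function.Injective f := by
  classical
  obtain ⟨σ, hσ⟩ := J.exists_linearMap_residueField_injective hJ hN
  have ht : Module.IsTorsionBySet R M (IsLocalRing.maximalIdeal R) := fun m r => hM r r.2 m
  let := ht.module
  let : Field (R ⧸ IsLocalRing.maximalIdeal R) := Ideal.Quotient.field _
  let b := Module.Basis.ofVectorSpace (R ⧸ IsLocalRing.maximalIdeal R) M
  let X := Module.Basis.ofVectorSpaceIndex (R ⧸ IsLocalRing.maximalIdeal R) M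
  let e1 : M ≃ₗ[R] (X →₀ R ⧸ IsLocalRing.maximalIdeal R) := b.repr.restrictScalars R
  let e2 : (X →₀ R ⧸ J) ≃ₗ[R] ((X →₀ R) ⧸ (J • ⊤ : Submodule R (X →₀ R))) :=
    (TensorProduct.finsuppScalarRight R R (R ⧸ J) X).symm.trans
      (TensorProduct.quotTensorEquivQuotSMul (X →₀ R) J)
  refine ⟨X, e2.toLinearMap ∘ₗ Finsupp.mapRange.linearMap σ ∘ₗ e1.toLinearMap, ?_⟩
  exact e2.injective.comp ((Finsupp.mapRange_injective σ (map_zero σ) hσ).comp e1.injective)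

/-- If `Ext^k(-, Q)` vanishes for `k ≫ 0` and `rs` is a regular sequence generating an ideal that is
primary to the maximal ideal, then `Ext^k(M, Q) = 0` for `k > rs.length` whenever `rs`
annihilates `M`. -/
lemma ExtVanishes.of_length_lt [IsLocalRing R] {rs : List R} (hrs : IsRegular R rs)
    {N : ℕ} (hN : IsLocalRing.maximalIdeal R ^ N ≤ Ideal.ofList rs) {n : ℕ}
    (hQ : ∀ k, n < k → ∀ (M : Type u) [AddCommGroup M] [Module R M], ExtVanishes R M Q k)
    (hM : ∀ r ∈ Ideal.ofList rs, ∀ m : M, r • m = 0) {k : ℕ} (hk : rs.length < k) :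
    ExtVanishes R M Q k := by
  have hJ : Ideal.ofList rs ≠ ⊤ := by
    have := hrs.2
    rw [smul_eq_mul, Ideal.mul_top] at this
    exact this.symm
  -- Descending induction on `k`, starting above `n`.
  suffices h : ∀ j k, rs.length < k → n < k + j → ∀ (M : Type u) [AddCommGroup M] [Module R M],
      (∀ r ∈ Ideal.ofList rs, ∀ m : M, r • m = 0) → ExtVanishes R M Q k from
    h (n + 1) k hk (by lia) M hM
  intro j
  induction j with
  | zero => exact fun k _ hk M _ _ _ => hQ k hk M
  | succ j ih =>
    intro k hk hkj
    -- A vector space `V` over the residue field embeds in `F/JF` with `F` free. That module has no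
    -- `Ext^k` for `k > rs.length`, and the cokernel is killed by `J`, so its `Ext^(k+1)` vanishes
    -- by induction.
    have hV : ∀ (V : Type u) [AddCommGroup V] [Module R V],
        (∀ r ∈ IsLocalRing.maximalIdeal R, ∀ m : V, r • m = 0) → ExtVanishes R V Q k := by
      intro V _ _ hV
      obtain ⟨X, f, hf⟩ := exists_linearMap_finsupp_quotient_injective hJ hN hV
      have hex : Function.Exact f (LinearMap.range f).mkQ := by
        rw [LinearMap.exact_iff, Submodule.ker_mkQ]
      refine .contravariant_left hf hex (Submodule.mkQ_surjective _) ?_ ?_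
      · refine ExtVanishes.quotient_of_isWeaklyRegular (c := 0)
          (isWeaklyRegular_finsupp hrs.1 X) (fun k hk => ?_) (by lia)
        obtain ⟨k, rfl⟩ := Nat.exists_eq_succ_of_ne_zero hk.ne'
        exact .of_projective k
      · refine ih (k + 1) (by lia) (by lia) _ fun r hr y => ?_
        obtain ⟨y, rfl⟩ := Submodule.Quotient.mk_surjective _ y
        obtain ⟨y, rfl⟩ := Submodule.Quotient.mk_surjective _ y
        rw [← Submodule.Quotient.mk_smul, ← Submodule.Quotient.mk_smul,
          (Submodule.Quotient.mk_eq_zero (Ideal.ofList rs • ⊤)).2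
            (Submodule.smul_mem_smul hr trivial), Submodule.Quotient.mk_zero]
    have hfil : ∀ (i : ℕ) (V : Type u) [AddCommGroup V] [Module R V],
        (∀ r ∈ IsLocalRing.maximalIdeal R ^ i, ∀ m : V, r • m = 0) → ExtVanishes R V Q k := by
      intro i
      induction i with
      | zero =>
        intro V _ _ hV
        have : Subsingleton V := subsingleton_of_forall_eq 0 fun v => by
          rw [← one_smul R v, hV 1 (by simp)]
        exact .of_subsingleton_left k
      | succ i ihi =>
        intro V _ _ hV'
        let W : Submodule R V := IsLocalRing.maximalIdeal R • ⊤
        have hex : Function.Exact W.subtype W.mkQ := by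
          rw [LinearMap.exact_iff, Submodule.ker_mkQ, Submodule.range_subtype]
        refine .contravariant_mid W.subtype_injective hex W.mkQ_surjective
          (ihi W fun r hr w => ?_) (hV (V ⧸ W) fun r hr v => ?_)
        · ext
          have h2 : W ≤ LinearMap.ker (LinearMap.lsmul R V r) := by
            refine Submodule.smul_le.2 fun s hs v _ => ?_
            simp only [LinearMap.mem_ker, LinearMap.lsmul_apply, ← mul_smul]
            exact hV' _ (by rw [pow_succ]; exact Ideal.mul_mem_mul hr hs) v
          exact h2 w.2
        · obtain ⟨v, rfl⟩ := Submodule.Quotient.mk_surjective _ v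
          rw [← Submodule.Quotient.mk_smul, Submodule.Quotient.mk_eq_zero]
          exact Submodule.smul_mem_smul hr trivial
    exact fun M _ _ hM => hfil N M fun r hr m => hM r (hN hr) m

/-- If `Hom(D, K) = 0`, some element of the annihilator of `D` is regular on `K`; here that element
is `0`. -/
lemma subsingleton_of_subsingleton_linearMap [IsNoetherianRing R] {D K : Type u} [AddCommGroup D]
    [Module R D] [Module.Finite R D] [AddCommGroup K] [Module R K] [Module.Finite R K]
    (hD : Module.annihilator R D = ⊥) (h : Subsingleton (D →ₗ[R] K)) : Subsingleton K := by
  obtain ⟨r, hr, hreg⟩ := IsSMulRegular.subsingleton_linearMap_iff.1 h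
  rw [hD, Ideal.mem_bot] at hr
  subst hr
  exact ⟨fun a b => hreg (by simp)⟩

/-- If `D` is a faithful finite module with `Ext^i(D, Y) = 0` for all `i ≥ 1`, then every weakly
regular sequence on `Hom(D, Y)` is weakly regular on `Y`. -/
lemma isWeaklyRegular_of_linearMap [IsNoetherianRing R] {D A Y : Type u} [AddCommGroup D]
    [Module R D] [Module.Finite R D] [AddCommGroup A] [Module R A] [AddCommGroup Y] [Module R Y]
    [Module.Finite R Y] (hD : Module.annihilator R D = ⊥) (e : A ≃ₗ[R] (D →ₗ[R] Y))
    (hY : ∀ i, ExtVanishes R D Y (i + 1)) {rs : List R} (h : IsWeaklyRegular A rs) :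
    IsWeaklyRegular Y rs := by
  induction rs generalizing A Y with
  | nil => simp
  | cons x rs ih =>
    rw [isWeaklyRegular_cons_iff] at h ⊢
    have hx : IsSMulRegular Y x := by
      have hK : Subsingleton (LinearMap.ker (LinearMap.lsmul R Y x)) := by
        refine subsingleton_of_subsingleton_linearMap hD ⟨fun f g => ?_⟩
        have hreg := (e.isSMulRegular_congr x).1 h.1
        have : (LinearMap.ker (LinearMap.lsmul R Y x)).subtype ∘ₗ f =
            (LinearMap.ker (LinearMap.lsmul R Y x)).subtype ∘ₗ g := by
          refine hreg ?_
          ext d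
          exact (f d).2.trans (g d).2.symm
        exact (LinearMap.cancel_left (Submodule.subtype_injective _)).1 this
      have := Submodule.subsingleton_iff_eq_bot.1 hK
      exact LinearMap.ker_eq_bot.1 this
    refine ⟨hx, ?_⟩
    have hex := LinearMap.exact_lsmul_mkQ_smul_top Y x
    have hs : Function.Surjective (x • (⊤ : Submodule R Y)).mkQ := Submodule.mkQ_surjective _
    let g : A →ₗ[R] (D →ₗ[R] QuotSMulTop x Y) :=
      LinearMap.compRight R (x • (⊤ : Submodule R Y)).mkQ ∘ₗ e.toLinearMap
    -- Since `Ext^1(D, Y) = 0`, `A/xA ≅ Hom(D, Y/xY)`, so the induction continues with `Y/xY`.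
    have hg : Function.Surjective g := by
      intro φ
      obtain ⟨ψ, hψ⟩ := (hY 0).exists_lift hx.linearMap_injective hex hs φ
      obtain ⟨a, rfl⟩ := e.surjective ψ
      exact ⟨a, hψ⟩
    have hker : LinearMap.ker g = x • (⊤ : Submodule R A) := by
      ext a
      rw [Submodule.mem_smul_pointwise_iff_exists]
      constructor
      · intro ha
        have hle (d : D) : ∃ y, x • y = e a d := (hex (e a d)).1 (LinearMap.congr_fun ha d)
        choose y hy using hle
        let ψ : D →ₗ[R] Y :=
          { toFun := y
            map_add' := fun c d => hx (by simp [hy])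
            map_smul' := fun r d => hx (by
              change x • y (r • d) = x • r • y d
              rw [smul_comm x r, hy, hy, map_smul]) }
        refine ⟨e.symm ψ, trivial, e.injective ?_⟩
        rw [map_smul, e.apply_symm_apply]
        ext d
        exact hy d
      · rintro ⟨b, -, rfl⟩
        ext d
        change (x • (⊤ : Submodule R Y)).mkQ (e (x • b) d) = 0
        rw [map_smul]
        exact (Submodule.Quotient.mk_eq_zero _).2 (Submodule.smul_mem_pointwise_smul _ _ _ trivial)
    refine ih ((Submodule.quotEquivOfEq _ _ hker.symm).trans
      (LinearMap.quotKerEquivOfSurjective g hg)) (fun i => ?_) h.2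
    exact .covariant_right hx.linearMap_injective hex hs (hY i) (hY (i + 1))

end LocalRings

/-! ### Ext from injective modules over a Cohen–Macaulay local ring -/

section LocalRings

open Abelian RingTheory.Sequence Pointwise

/-- The quotient by `rs` has dimension zero, so it is artinian with nilpotent maximal ideal. -/
lemma IsLocalRing.exists_maximalIdeal_pow_le_ofList {R : Type u} [CommRing R] [IsNoetherianRing R]
    [IsLocalRing R] {rs : List R} (hrs : IsRegular R rs) (hdim : ringKrullDim R = rs.length) :
    ∃ N : ℕ, IsLocalRing.maximalIdeal R ^ N ≤ Ideal.ofList rs := by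
  have hJ : Ideal.ofList rs ≠ ⊤ := by
    have := hrs.2
    rw [smul_eq_mul, Ideal.mul_top] at this
    exact this.symm
  have : Nontrivial (R ⧸ Ideal.ofList rs) := Ideal.Quotient.nontrivial_iff.2 hJ
  have h1 := ringKrullDim_add_length_eq_ringKrullDim_of_isRegular rs hrs
  rw [hdim] at h1
  have h0 : ringKrullDim (R ⧸ Ideal.ofList rs) = 0 := by
    generalize ringKrullDim (R ⧸ Ideal.ofList rs) = d at h1
    induction d with
    | bot => simp at h1
    | coe d =>
      have h2 : d + (rs.length : ℕ∞) = (rs.length : ℕ∞) := by exact_mod_cast h1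
      have h3 : d = 0 := by
        induction d with
        | top => simp at h2
        | coe d =>
          have : d + rs.length = rs.length := by exact_mod_cast h2
          simp_all
      rw [h3]
      rfl
  have : Ring.KrullDimLE 0 (R ⧸ Ideal.ofList rs) := by
    rw [Ring.KrullDimLE, Order.krullDimLE_iff, ← ringKrullDim, h0]
    rfl
  have : IsArtinianRing (R ⧸ Ideal.ofList rs) := isArtinianRing_iff_krullDimLE_zero.2 this
  have hloc : IsLocalRing (R ⧸ Ideal.ofList rs) :=
    .of_surjective' (Ideal.Quotient.mk _) Ideal.Quotient.mk_surjective
  obtain ⟨N, hN⟩ := (isArtinianRing_iff_isNilpotent_maximalIdeal _).1 this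
  refine ⟨N, ?_⟩
  rw [← Ideal.mk_ker (I := Ideal.ofList rs), RingHom.ker, ← Ideal.map_le_iff_le_comap,
    Ideal.map_pow]
  refine (Ideal.pow_right_mono ?_ N).trans hN.le
  exact ((IsLocalRing.local_hom_TFAE (Ideal.Quotient.mk (Ideal.ofList rs))).out 0 2).1
    (IsLocalHom.of_surjective _ Ideal.Quotient.mk_surjective)

lemma exists_pow_smul_linearMap_eq_zero {R : Type u} [CommRing R] {D E : Type u} [AddCommGroup D]
    [Module R D] [Module.Finite R D] [AddCommGroup E] [Module R E] {x : R}
    (hE : ∀ e : E, ∃ n : ℕ, x ^ n • e = 0) (t : D →ₗ[R] E) : ∃ n : ℕ, x ^ n • t = 0 := by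
  obtain ⟨s, hs⟩ := Module.Finite.fg_top (R := R) (M := D)
  choose n hn using hE
  refine ⟨s.sup fun d => n (t d), LinearMap.ext_on hs fun d hd => ?_⟩
  have := Finset.le_sup (f := fun d => n (t d)) hd
  obtain ⟨m, hm⟩ := Nat.exists_eq_add_of_le this
  rw [hm, add_comm, pow_add, LinearMap.smul_apply, mul_smul, hn, smul_zero, LinearMap.zero_apply]

/-- Over a Cohen–Macaulay local ring `R` of dimension `d` with dualizing module `D`, and for `E`
an injective module whose elements are killed by powers of the maximal ideal,
`Ext^k(I, Hom(D, E)⁺) = 0` for all injective modules `I` and `k ≠ d`. -/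
theorem HomCharacter.extVanishes_of_injective {R : Type u} [CommRing R] [IsNoetherianRing R]
    [IsLocalRing R] {D E I : Type u} [AddCommGroup D] [Module R D] [Module.Finite R D]
    [AddCommGroup E] [Module R E] [AddCommGroup I] [Module R I] (e : R ≃ₗ[R] (D →ₗ[R] D))
    (hDD : ∀ i, ExtVanishes R D D (i + 1)) {n : ℕ}
    (hD : HasInjectiveDimensionLE (ModuleCat.of R D) n) {rs : List R} (hrs : IsRegular R rs)
    (hmem : ∀ r ∈ rs, r ∈ IsLocalRing.maximalIdeal R) (hdim : ringKrullDim R = rs.length)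
    (hE : Module.Injective R E)
    (htors : ∀ x ∈ IsLocalRing.maximalIdeal R, ∀ y : E, ∃ n : ℕ, x ^ n • y = 0)
    (hI : Module.Injective R I) {k : ℕ} (hk : k ≠ rs.length) :
    ExtVanishes R I (HomCharacter (R := R) E D) k := by
  have hann : Module.annihilator R D = ⊥ := by
    refine (Submodule.eq_bot_iff _).2 fun r hr => e.injective ?_
    rw [map_zero, ← mul_one r, ← smul_eq_mul, map_smul]
    ext d
    exact Module.mem_annihilator.1 hr _
  obtain ⟨N, hN⟩ := IsLocalRing.exists_maximalIdeal_pow_le_ofList hrs hdim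
  -- Regularity passes from `R ≅ Hom(D, D)` to `D`, then to `Hom(D, E)⁺`.
  have hreg : IsWeaklyRegular (HomCharacter (R := R) E D) rs :=
    isWeaklyRegular hE (isWeaklyRegular_of_linearMap hann e hDD hrs.1)
  refine (extVanishes_linearMap_of_isWeaklyRegular (T := D →ₗ[R] E) hI hrs.1
    (fun r hr t => exists_pow_smul_linearMap_eq_zero (htors r (hmem r hr)) t)
    fun M _ _ hM _ => ?_).congr_left (LinearMap.ringLmapEquivSelf R R I)
  rcases lt_or_gt_of_ne hk with hlt | hgt
  · exact .of_isWeaklyRegular hreg hM hlt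
  · refine .of_length_lt hrs hN
      (fun k hk M _ _ => extVanishes_of_hasInjectiveDimensionLE hE hD hk M) (fun r hr m => ?_) hgt
    have : Ideal.ofList rs ≤ LinearMap.ker (LinearMap.toSpanSingleton R M m) :=
      Ideal.span_le.2 fun s hs => hM s hs m
    exact this hr

end LocalRings

/-! ### Ext and localization -/

section Localization

variable {R : Type u} [CommRing R] (P : Submonoid R) {K F M N Q : Type u} [AddCommGroup K]
  [Module R K] [AddCommGroup F] [Module R F] [AddCommGroup M] [Module R M] [AddCommGroup N]
  [Module R N] [AddCommGroup Q] [Module R Q] [Module (Localization P) Q]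
  [IsScalarTower R (Localization P) Q]

lemma LocalizedModule.map_function_exact {i : K →ₗ[R] F} {g : F →ₗ[R] M}
    (h : Function.Exact i g) : Function.Exact (LocalizedModule.map P i) (LocalizedModule.map P g) :=
  LocalizedModule.map_exact P i g h

lemma LocalizedModule.map_function_injective {i : K →ₗ[R] F} (h : Function.Injective i) :
    Function.Injective (LocalizedModule.map P i) :=
  IsLocalizedModule.map_injective P (LocalizedModule.mkLinearMap P K)
    (LocalizedModule.mkLinearMap P F) i h

lemma LocalizedModule.map_function_surjective {g : F →ₗ[R] M} (h : Function.Surjective g) :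
    Function.Surjective (LocalizedModule.map P g) :=
  IsLocalizedModule.map_surjective P (LocalizedModule.mkLinearMap P F)
    (LocalizedModule.mkLinearMap P M) g h

/-- In degree one, a map out of the localized syzygy is, up to a denominator, the localization of a
map out of `K`, which extends. Higher degrees follow by passing to syzygies. -/
lemma ExtVanishes.localizedModule [IsNoetherianRing R] [Module.Finite R M]
    (h : ∀ i, ExtVanishes R M N (i + 1)) (i : ℕ) :
    ExtVanishes (Localization P) (LocalizedModule P M) (LocalizedModule P N) (i + 1) := by
  induction i generalizing M with
  | zero =>
    obtain ⟨K, F, _, _, _, _, _, _, _, i, g, hi, hex, hg⟩ := exists_finite_free_presentation R M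
    refine .one_of_exists_extension (LocalizedModule.map_function_injective P hi)
      (LocalizedModule.map_function_exact P hex) (LocalizedModule.map_function_surjective P hg)
      (.of_projective 0) fun φ => ?_
    have : Module.FinitePresentation R K := Module.finitePresentation_of_finite R K
    obtain ⟨⟨φ₀, s⟩, hs⟩ := IsLocalizedModule.surj P (LocalizedModule.map P (M := K) (N := N)) φ
    obtain ⟨ψ₀, rfl⟩ := (h 0).exists_extension hi hex hg φ₀
    refine ⟨IsLocalization.mk' (Localization P) 1 s • LocalizedModule.map P ψ₀, ?_⟩
    have h1 : LocalizedModule.map P ψ₀ ∘ₗ LocalizedModule.map P i = (s : R) • φ := by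
      refine Eq.trans ?_ hs.symm
      ext x
      induction x with
      | h a b => simp
    rw [LinearMap.smul_comp, h1, ← algebraMap_smul (Localization P) (s : R) φ, ← mul_smul]
    simp
  | succ i ih =>
    obtain ⟨K, F, _, _, _, _, _, _, _, i, g, hi, hex, hg⟩ := exists_finite_free_presentation R M
    exact .contravariant_right (LocalizedModule.map_function_injective P hi)
      (LocalizedModule.map_function_exact P hex) (LocalizedModule.map_function_surjective P hg)
      (ih fun j => .contravariant_left hi hex hg (.of_projective j) (h (j + 1))) (.of_projective _)

lemma LocalizedModule.exists_lift (f : M →ₗ[R] Q) :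
    ∃ φ : LocalizedModule P M →ₗ[Localization P] Q,
      ∀ m, φ (LocalizedModule.mkLinearMap P M m) = f m :=
  ⟨(IsLocalizedModule.isBaseChange P (Localization P) (LocalizedModule.mkLinearMap P M)).lift f,
    IsBaseChange.lift_eq _ f⟩

/-- Maps `M → Q` factor through the localization of `M`, and localized free presentations are again
free presentations. -/
lemma ExtVanishes.of_localizedModule {k : ℕ}
    (h : ExtVanishes (Localization P) (LocalizedModule P M) Q k) : ExtVanishes R M Q k := by
  induction k generalizing M with
  | zero =>
    rw [extVanishes_zero_iff] at *
    refine ⟨fun f g => LinearMap.ext fun m => ?_⟩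
    obtain ⟨φ, hφ⟩ := LocalizedModule.exists_lift P f
    obtain ⟨ψ, hψ⟩ := LocalizedModule.exists_lift P g
    rw [← hφ, ← hψ, h.elim φ ψ]
  | succ k ih =>
    obtain ⟨K, F, _, _, _, _, _, i, g, hi, hex, hg⟩ := exists_free_presentation R M
    have hi' := LocalizedModule.map_function_injective P hi
    have hex' := LocalizedModule.map_function_exact P hex
    have hg' := LocalizedModule.map_function_surjective P hg
    cases k with
    | zero =>
      refine .one_of_exists_extension hi hex hg (.of_projective 0) fun f => ?_
      obtain ⟨φ, hφ⟩ := LocalizedModule.exists_lift P f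
      obtain ⟨ψ, hψ⟩ := h.exists_extension hi' hex' hg' φ
      refine ⟨ψ.restrictScalars R ∘ₗ LocalizedModule.mkLinearMap P F, ?_⟩
      ext x
      rw [← hφ, ← hψ]
      simp [LocalizedModule.mkLinearMap_apply]
    | succ k =>
      exact .contravariant_right hi hex hg
        (ih (.contravariant_left hi' hex' hg' (.of_projective k) h)) (.of_projective _)

end Localization

/-! ### From Ext into a character module to Tor -/

section TorExt

open TensorProduct

variable {R : Type u} [CommRing R] {A B C T : Type u} [AddCommGroup A] [Module R A]
  [AddCommGroup B] [Module R B] [AddCommGroup C] [Module R C] [AddCommGroup T] [Module R T]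

/-- Characters of `B ⊗ T` that kill the image of `f` are maps `B → T⁺` killing `f`. They factor
through `g`, so they vanish on `z`; characters separate points of the cokernel. -/
lemma exists_lTensor_apply_eq_of_exists_extension {f : A →ₗ[R] B} {g : B →ₗ[R] C}
    (h : ∀ φ : B →ₗ[R] CharacterModule T, φ ∘ₗ f = 0 →
      ∃ ψ : C →ₗ[R] CharacterModule T, ψ ∘ₗ g = φ)
    {z : T ⊗[R] B} (hz : g.lTensor T z = 0) : ∃ y, f.lTensor T y = z := by
  have key : TensorProduct.comm R T B z ∈ LinearMap.range (f.rTensor T) := by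
    rw [← Submodule.Quotient.mk_eq_zero]
    refine CharacterModule.eq_zero_of_character_apply fun c => ?_
    let c' : CharacterModule (B ⊗[R] T) :=
      CharacterModule.dual (LinearMap.range (f.rTensor T)).mkQ c
    obtain ⟨ψ, hψ⟩ := h (CharacterModule.curry c') (by
      ext a t
      change c (Submodule.Quotient.mk (f.rTensor T (a ⊗ₜ t))) = 0
      rw [(Submodule.Quotient.mk_eq_zero _).2 (LinearMap.mem_range_self _ _)]
      exact map_zero (c : _ →+ _))
    have h1 : c' = CharacterModule.dual (g.rTensor T) (CharacterModule.uncurry ψ) := by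
      apply (CharacterModule.homEquiv (R := R)).symm.injective
      refine Eq.trans ?_ (hψ.symm.trans ?_)
      · rfl
      · ext b t
        rfl
    have h2 : g.rTensor T (TensorProduct.comm R T B z) = TensorProduct.comm R T C (g.lTensor T z) :=
      LinearMap.congr_fun (LinearMap.rTensor_comp_comm g) z
    change c' (TensorProduct.comm R T B z) = 0
    rw [h1]
    change CharacterModule.uncurry ψ (g.rTensor T (TensorProduct.comm R T B z)) = 0
    rw [h2, hz, map_zero]
    exact map_zero (CharacterModule.uncurry ψ : _ →+ _)
  obtain ⟨y, hy⟩ := key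
  refine ⟨(TensorProduct.comm R T A).symm y, (TensorProduct.comm R T B).injective ?_⟩
  rw [← hy]
  have h3 : f.rTensor T (TensorProduct.comm R T A ((TensorProduct.comm R T A).symm y)) =
      TensorProduct.comm R T B (f.lTensor T ((TensorProduct.comm R T A).symm y)) :=
    LinearMap.congr_fun (LinearMap.rTensor_comp_comm f) _
  simpa using h3.symm

lemma isZero_tor_of_extVanishes {k : ℕ} (h : ExtVanishes R B (CharacterModule T) k) :
    Limits.IsZero (((Tor (ModuleCat.{u} R) k).obj (ModuleCat.of R T)).obj (ModuleCat.of R B)) := by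
  cases k with
  | zero =>
    have h1 := extVanishes_zero_iff.1 h
    have h2 : Subsingleton (T ⊗[R] B) := by
      have h3 : Subsingleton (B ⊗[R] T) := by
        refine subsingleton_of_forall_eq 0 fun z =>
          CharacterModule.eq_zero_of_character_apply fun c => ?_
        obtain ⟨φ, rfl⟩ := (CharacterModule.homEquiv (R := R)).surjective c
        rw [h1.elim φ 0, map_zero]
        rfl
      exact (TensorProduct.comm R T B).injective.subsingleton
    have h4 : Limits.IsZero (ModuleCat.of R (T ⊗[R] B)) := ModuleCat.isZero_of_subsingleton _
    exact h4.of_iso ((((MonoidalCategory.tensoringLeft (ModuleCat.{u} R)).obj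
      (ModuleCat.of R T)).leftDerivedZeroIsoSelf).app (ModuleCat.of R B))
  | succ k =>
    let P := projectiveResolution (ModuleCat.of R B)
    refine Limits.IsZero.of_iso ?_ (P.isoLeftDerivedObj
      ((MonoidalCategory.tensoringLeft (ModuleCat.{u} R)).obj (ModuleCat.of R T)) (k + 1))
    refine (HomologicalComplex.exactAt_iff_isZero_homology _ _).1 ?_
    rw [HomologicalComplex.exactAt_iff' _ (k + 2) (k + 1) k (by simp) (by simp),
      ShortComplex.moduleCat_exact_iff]
    intro z hz
    refine exists_lTensor_apply_eq_of_exists_extension (f := (P.complex.d (k + 2) (k + 1)).hom)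
      (g := (P.complex.d (k + 1) k).hom) (fun φ hφ => ?_) hz
    have hφ' : P.complex.d (k + 2) (k + 1) ≫ ModuleCat.ofHom φ = 0 := by
      ext1
      exact hφ
    obtain ⟨ψ, hψ⟩ := (P.extMk_eq_zero_iff (ModuleCat.ofHom φ) (k + 2) rfl hφ' k rfl).1
      (extVanishes_iff.1 h _)
    exact ⟨ψ.hom, congrArg ModuleCat.Hom.hom hψ⟩

end TorExt

/-! ### The action of `R` on the injective hull of `R ⧸ p` -/

section InjectiveHull

variable {R : Type u} [CommRing R] {p : Ideal R} {E : Type u} [AddCommGroup E]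
  [Module R E] {ι : (R ⧸ p) →ₗ[R] E}

/-- Fitting's argument on the cyclic module `N = Re`: for large `m`, the kernel and range of `x ^ m`
are disjoint. Elements of the range lying in `R ⧸ p` are killed by `x`, hence zero, so the range is
zero by essentiality. -/
lemma IsInjectiveHull.exists_pow_smul_eq_zero [IsNoetherianRing R] (hE : IsInjectiveHull ι) {x : R}
    (hx : x ∈ p) (e : E) : ∃ n : ℕ, x ^ n • e = 0 := by
  let N : Submodule R E := Submodule.span R {e}
  let f : N →ₗ[R] N := LinearMap.lsmul R N x
  have hf (n : ℕ) (y : N) : (f ^ n) y = x ^ n • y := by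
    induction n with
    | zero => simp
    | succ n ih =>
      rw [pow_succ', Module.End.mul_apply, ih, pow_succ', mul_smul]
      rfl
  have hN : IsNoetherian R N := isNoetherian_of_isNoetherianRing_of_finite R N
  obtain ⟨n, hn⟩ := Filter.eventually_atTop.1 (Module.End.eventually_disjoint_ker_pow_range_pow f)
  -- A positive exponent is needed for `x • y = 0` to give `x ^ m • y = 0`.
  have hd := hn (max n 1) (le_max_left _ _)
  refine ⟨max n 1, ?_⟩
  generalize hm : max n 1 = m at hd
  have hm1 : 1 ≤ m := hm ▸ le_max_right _ _
  have h0 : (LinearMap.range (f ^ m)).map N.subtype = ⊥ := by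
    refine hE.essential _ ((Submodule.eq_bot_iff _).2 ?_)
    rintro _ ⟨⟨y, hy, rfl⟩, ⟨r, hr⟩⟩
    have hxy : x • (N.subtype y) = 0 := by
      rw [← hr, ← map_smul]
      obtain ⟨r, rfl⟩ := Ideal.Quotient.mk_surjective r
      have : x • (Ideal.Quotient.mk p r) = 0 := by
        rw [Algebra.smul_def, Ideal.Quotient.algebraMap_eq, Ideal.Quotient.eq_zero_iff_mem.2 hx,
          zero_mul]
      rw [this, map_zero]
    have hyk : y ∈ LinearMap.ker (f ^ m) := by
      rw [LinearMap.mem_ker, hf]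
      obtain ⟨l, rfl⟩ := Nat.exists_eq_add_of_le' hm1
      have : x • y = 0 := Subtype.ext hxy
      rw [pow_succ, mul_smul, this, smul_zero]
    rw [Submodule.disjoint_def.1 hd y hyk hy, map_zero]
  have h1 : N.subtype ((f ^ m) ⟨e, Submodule.mem_span_singleton_self e⟩) ∈
      (LinearMap.range (f ^ m)).map N.subtype := ⟨_, ⟨_, rfl⟩, rfl⟩
  rw [h0, Submodule.mem_bot, hf] at h1
  exact h1

/-- The kernel of `s` meets `R ⧸ p` trivially, so `s` is injective by essentiality. Extending the
identity of `E` along `s` then inverts it. -/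
lemma IsInjectiveHull.smul_bijective [p.IsPrime] (hE : IsInjectiveHull ι) {s : R} (hs : s ∉ p) :
    Function.Bijective (LinearMap.lsmul R E s) := by
  have hinj : Function.Injective (LinearMap.lsmul R E s) := by
    refine LinearMap.ker_eq_bot.1 (hE.essential _ ((Submodule.eq_bot_iff _).2 ?_))
    rintro _ ⟨hy, ⟨r, rfl⟩⟩
    obtain ⟨r, rfl⟩ := Ideal.Quotient.mk_surjective r
    have h1 : s • ι (Ideal.Quotient.mk p r) = 0 := hy
    rw [← map_smul, map_eq_zero_iff ι hE.injective_map, Algebra.smul_def,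
      Ideal.Quotient.algebraMap_eq, ← map_mul, Ideal.Quotient.eq_zero_iff_mem] at h1
    rw [Ideal.Quotient.eq_zero_iff_mem.2 ((Ideal.IsPrime.mem_or_mem ‹_› h1).resolve_left hs),
      map_zero]
  refine ⟨hinj, fun e => ?_⟩
  have := hE.injective_module
  obtain ⟨r, hr⟩ := Module.Injective.extension_property R E _ _ _ hinj LinearMap.id
  refine ⟨r e, ?_⟩
  rw [LinearMap.lsmul_apply, ← map_smul]
  exact LinearMap.congr_fun hr e

end InjectiveHull

/-! ### Attained depth, and shifting along a complete resolution -/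

lemma exists_isRegular_of_localRingDepth_eq {A : Type u} [CommRing A] [IsLocalRing A] {d : ℕ}
    (h : localRingDepth A = d) : ∃ rs : List A, RingTheory.Sequence.IsRegular A rs ∧
      (∀ r ∈ rs, r ∈ IsLocalRing.maximalIdeal A) ∧ rs.length = d := by
  by_contra! hne
  cases d with
  | zero => exact hne [] (.nil A A) (by simp) rfl
  | succ d =>
    have h1 : localRingDepth A ≤ d := by
      refine iSup₂_le fun rs hrs => iSup_le fun hmem => ?_
      have h2 : (rs.length : ℕ∞) ≤ localRingDepth A :=
        le_iSup₂_of_le rs hrs (le_iSup_of_le hmem le_rfl)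
      rw [h] at h2
      have h3 : rs.length ≤ d + 1 := by exact_mod_cast h2
      have := hne rs hrs hmem
      exact_mod_cast (show rs.length ≤ d by lia)
    rw [h] at h1
    have : d + 1 ≤ d := by exact_mod_cast h1
    lia

/-- Below `c`, shifting left ends in degree `0`, where a quotient of an injective inherits the
vanishing of Hom. Above `c`, shifting right raises the degree past `N`. -/
lemma IsCompleteInjectiveResolution.extVanishes_range {R : Type u} [CommRing R]
    {E : ℤ → ModuleCat.{u} R} {d : ∀ n : ℤ, E n →ₗ[R] E (n + 1)}
    (h : IsCompleteInjectiveResolution E d) {Q : Type u} [AddCommGroup Q] [Module R Q] {c N : ℕ}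
    (hI : ∀ (I : Type u) [AddCommGroup I] [Module R I], Module.Injective R I → ∀ k, k ≠ c →
      ExtVanishes R I Q k)
    (hN : ∀ (M : Type u) [AddCommGroup M] [Module R M], ∀ k, N < k → ExtVanishes R M Q k)
    (n : ℤ) {k : ℕ} (hk : k ≠ c) : ExtVanishes R (LinearMap.range (d n)) Q k := by
  have hinj (n : ℤ) : Function.Injective (LinearMap.range (d n)).subtype :=
    Submodule.subtype_injective _
  have hsurj (n : ℤ) : Function.Surjective (d n).rangeRestrict := (d n).surjective_rangeRestrict
  have hex (n : ℤ) :
      Function.Exact (LinearMap.range (d n)).subtype (d (n + 1)).rangeRestrict := by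
    rw [LinearMap.exact_iff, LinearMap.ker_rangeRestrict, Submodule.range_subtype]
    exact LinearMap.exact_iff.1 (h.exact n)
  rcases lt_or_gt_of_ne hk with hlt | hgt
  · induction k generalizing n with
    | zero => exact .zero_of_surjective (hsurj n) (hI _ (h.injective n) 0 hk)
    | succ k ih =>
      obtain ⟨m, rfl⟩ : ∃ m, n = m + 1 := ⟨n - 1, by ring⟩
      exact .contravariant_right (hinj m) (hex m) (hsurj _) (ih m (by lia) (by lia))
        (hI _ (h.injective _) _ hk)
  · suffices H : ∀ j k n, c < k → N < k + j → ExtVanishes R (LinearMap.range (d n)) Q k from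
      H (N + 1) k n hgt (by lia)
    intro j
    induction j with
    | zero => exact fun k n _ hk => hN _ k hk
    | succ j ih =>
      intro k n hk hkj
      exact .contravariant_left (hinj n) (hex n) (hsurj _) (hI _ (h.injective _) _ hk.ne')
        (ih (k + 1) (n + 1) (by lia) (by lia))

/-! ### Hom under localization, and the final assembly -/

section LocalizedHom

variable {R : Type u} [CommRing R] (P : Submonoid R)

lemma isLocalizedModule_id_of_bijective {M : Type u} [AddCommGroup M] [Module R M]
    (h : ∀ s ∈ P, Function.Bijective (LinearMap.lsmul R M s)) :
    IsLocalizedModule P (LinearMap.id : M →ₗ[R] M) where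
  map_units s := (Module.End.isUnit_iff _).2 (h s s.2)
  surj y := ⟨⟨y, 1⟩, by simp⟩
  exists_of_eq h := ⟨1, by simpa using h⟩

/-- If `P` acts invertibly on `E` and `D` is finitely presented, then
`Hom_R(D, E) ≃ Hom_{P⁻¹R}(P⁻¹D, P⁻¹E)`. -/
lemma nonempty_linearMap_equiv_localizedModule {D E : Type u} [AddCommGroup D] [Module R D]
    [Module.FinitePresentation R D] [AddCommGroup E] [Module R E]
    (h : ∀ s ∈ P, Function.Bijective (LinearMap.lsmul R E s)) :
    Nonempty ((LocalizedModule P D →ₗ[Localization P] LocalizedModule P E) ≃ₗ[R]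
      (D →ₗ[R] E)) := by
  have hid : IsLocalizedModule P (LinearMap.id : (D →ₗ[R] E) →ₗ[R] (D →ₗ[R] E)) := by
    refine isLocalizedModule_id_of_bijective P fun s hs => ⟨fun f g hfg => ?_, fun f => ?_⟩
    · ext d
      exact (h s hs).1 (LinearMap.congr_fun hfg d)
    · let e := LinearEquiv.ofBijective _ (h s hs)
      refine ⟨e.symm.toLinearMap ∘ₗ f, LinearMap.ext fun d => ?_⟩
      exact e.apply_symm_apply (f d)
  exact ⟨IsLocalizedModule.linearEquiv P (LocalizedModule.map P (M := D) (N := E)) LinearMap.id⟩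

lemma nonempty_localization_equiv_linearMap {D : Type u} [AddCommGroup D] [Module R D]
    [Module.FinitePresentation R D] (h : Function.Bijective (LinearMap.lsmul R D)) :
    Nonempty (Localization P ≃ₗ[Localization P]
      (LocalizedModule P D →ₗ[Localization P] LocalizedModule P D)) := by
  let e : R ≃ₗ[R] (D →ₗ[R] D) := LinearEquiv.ofBijective _ h
  have := IsLocalizedModule.of_linearEquiv_right P (LocalizedModule.map P (M := D) (N := D)) e
  exact ⟨(IsLocalizedModule.linearEquiv P (Algebra.linearMap R (Localization P))
    (LocalizedModule.map P (M := D) (N := D) ∘ₗ e.toLinearMap)).extendScalarsOfIsLocalization P _⟩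

lemma exists_pow_smul_localizedModule_eq_zero {p : Ideal R} [p.IsPrime] {E : Type u}
    [AddCommGroup E] [Module R E] (h : ∀ x ∈ p, ∀ e : E, ∃ n : ℕ, x ^ n • e = 0)
    {x : Localization.AtPrime p} (hx : x ∈ IsLocalRing.maximalIdeal (Localization.AtPrime p))
    (y : LocalizedModule p.primeCompl E) : ∃ n : ℕ, x ^ n • y = 0 := by
  obtain ⟨a, s, rfl⟩ := IsLocalization.exists_mk'_eq p.primeCompl x
  have ha : a ∈ p := (IsLocalization.AtPrime.mk'_mem_maximal_iff _ p a s).1 hx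
  induction y with
  | h e t =>
    obtain ⟨n, hn⟩ := h a ha e
    refine ⟨n, ?_⟩
    rw [← IsLocalization.mk'_pow, ← Localization.mk_eq_mk', LocalizedModule.mk_smul_mk, hn,
      LocalizedModule.zero_mk]

end LocalizedHom

lemma IsCohenMacaulayRing.exists_isRegular {R : Type u} [CommRing R] (hR : IsCohenMacaulayRing R)
    (p : Ideal R) [p.IsPrime] : ∃ rs : List (Localization.AtPrime p),
      RingTheory.Sequence.IsRegular (Localization.AtPrime p) rs ∧
      (∀ r ∈ rs, r ∈ IsLocalRing.maximalIdeal (Localization.AtPrime p)) ∧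
      ringKrullDim (Localization.AtPrime p) = rs.length ∧ p.height = rs.length := by
  have := hR.1
  have h1 := hR.2 p
  rw [IsLocalization.AtPrime.ringKrullDim_eq_height p] at h1
  have h2 : localRingDepth (Localization.AtPrime p) = p.height := by exact_mod_cast h1
  obtain ⟨d, hd⟩ := ENat.ne_top_iff_exists.1 (Ideal.height_ne_top (Ideal.IsPrime.ne_top ‹_›))
  rw [← hd] at h2
  obtain ⟨rs, hrs, hmem, rfl⟩ := exists_isRegular_of_localRingDepth_eq h2
  refine ⟨rs, hrs, hmem, ?_, hd.symm⟩
  rw [IsLocalization.AtPrime.ringKrullDim_eq_height p, ← hd]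
  rfl

theorem proposition20141003p2 (R : Type u) [CommRing R] (hR : IsCohenMacaulayRing R)
    (D : Type u) [AddCommGroup D] [Module R D] (hD : IsDualizingModule R D)
    (p : Ideal R) [p.IsPrime]
    (E : Type u) [AddCommGroup E] [Module R E] (ι : (R ⧸ p) →ₗ[R] E) (hE : IsInjectiveHull ι)
    (G : Type u) [AddCommGroup G] [Module R G] (hG : IsGorensteinInjective R G)
    (k : ℕ) (hk : (k : ℕ∞) ≠ p.height) :
    Limits.IsZero
      (((Tor (ModuleCat.{u} R) k).obj (ModuleCat.of R (D →ₗ[R] E))).obj (ModuleCat.of R G)) := by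
  have := hR.1
  have := hD.finite
  have : Module.FinitePresentation R D := Module.finitePresentation_of_finite R D
  obtain ⟨rs, hrs, hmem, hdim, hht⟩ := hR.exists_isRegular p
  have hk' : k ≠ rs.length := fun h => hk (by rw [hht, h])
  let S := Localization.AtPrime p
  let Dp := LocalizedModule p.primeCompl D
  let Ep := LocalizedModule p.primeCompl E
  let Q := HomCharacter (R := S) Ep Dp
  have hQ : IsScalarTower R S Q := ⟨fun r s c => by
    ext t
    change c ((r • s) • t) = c (s • r • t)
    rw [smul_assoc, smul_comm]⟩
  obtain ⟨eD⟩ := nonempty_localization_equiv_linearMap p.primeCompl hD.homothety_bijective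
  have hDD : ∀ i, ExtVanishes S Dp Dp (i + 1) :=
    ExtVanishes.localizedModule p.primeCompl fun i => hD.ext_subsingleton (i + 1) (by lia)
  obtain ⟨n, hn⟩ := hD.finite_injectiveDimension
  have hn' : HasInjectiveDimensionLE (ModuleCat.of S Dp) n :=
    (ModuleCat.hasInjectiveDimensionLE_iff_of_linearEquiv
      (N := ModuleCat.of S Dp) (Shrink.linearEquiv S Dp) n).1
      (ModuleCat.localizedModule_hasInjectiveDimensionLE n p.primeCompl (ModuleCat.of R D))
  have hloc (I : Type u) [AddCommGroup I] [Module R I] (hI : Module.Injective R I) :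
      Module.Injective S (LocalizedModule p.primeCompl I) :=
    Module.injective_of_isLocalizedModule p.primeCompl (LocalizedModule.mkLinearMap p.primeCompl I)
  have hEp : Module.Injective S Ep := hloc E hE.injective_module
  obtain ⟨X, d, hX, ⟨e⟩⟩ := hG
  have hext : ExtVanishes R (LinearMap.range (d 0)) Q k :=
    hX.extVanishes_range
      (fun I _ _ hI k hk => .of_localizedModule p.primeCompl
        (HomCharacter.extVanishes_of_injective eD hDD hn' hrs hmem hdim hEp
          (fun x hx y => exists_pow_smul_localizedModule_eq_zero
            (fun x hx e => hE.exists_pow_smul_eq_zero hx e) hx y) (hloc I hI) hk))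
      (fun M _ _ k hk => .of_localizedModule p.primeCompl
        (HomCharacter.extVanishes_of_hasInjectiveDimensionLE hEp hn' hk _)) 0 hk'
  -- As `E` is already `p`-local, the Hom module over `S` is `Hom_R(D, E)`, so `Q` is its character
  -- module.
  obtain ⟨f⟩ := nonempty_linearMap_equiv_localizedModule (D := D) p.primeCompl
    fun s hs => hE.smul_bijective hs
  exact isZero_tor_of_extVanishes
    ((hext.congr_left e.symm).congr_right (CharacterModule.congr f))
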